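/- Let $V$ be a finite-dimensional real vector space and let $\mathcal{A}$ be a finite set of linear hyperplanes (subspaces of codimension one) of $V$ that is essential, i.e. $\bigcap_{H\in\mathcal{A}}H=\{\mathbf 0\}$ (the empty intersection being $V$). Let $\mathcal{C}(\mathcal{A})$ be the set of (closed) chambers of $\mathcal{A}$, i.e. the closures of the connected components of $V\setminus\bigcup_{H\in\mathcal{A}}H$. Let $\mathcal{L}_{\mathcal{A}}$ be the set of all intersections of subfamilies of $\mathcal{A}$ (including $V$, the intersection of the empty subfamily), ordered by inverse inclusion, with Möbius function $\mu$, let $$\chi(\mathcal{A},t)=\sum_{X\in\mathcal{L}_{\mathcal{A}}}\mu(V,X)\,t^{\dim X}$$ be the characteristic polynomial, and let $$\beta(\mathcal{A})=(-1)^{\operatorname{rank}(\mathcal{A})-1}\,\frac{\mathrm d\chi(\mathcal{A},t)}{\mathrm dt}\Big|_{t=1},\qquad \operatorname{rank}(\mathcal{A})=\dim V-\dim\bigcap_{H\in\mathcal{A}}H,$$ be Crapo's beta invariant (for essential $\mathcal{A}$, the rank is $\dim V$). For a subset $\mathcal{P}\subseteq\mathcal{A}$ and a chamber $C$ let $$\mathcal{F}_{\mathcal{A},\mathcal{P}}(C)=\{H\in\mathcal{P}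 : H\cap C=\{\mathbf 0\}\}$$ be the set of faraway planes of $C$ that belong to $\mathcal{P}$. Then, for every subset $\mathcal{P}\subseteq\mathcal{A}$, $$\sum_{C\in\mathcal{C}(\mathcal{A})}\big|\mathcal{F}_{\mathcal{A},\mathcal{P}}(C)\big|=2\cdot|\mathcal{P}|\cdot\beta(\mathcal{A}).$$ -/

import Mathlib

/-- A real central hyperplane arrangement in `V`: a finite set of linear hyperplanes, that is, of
linear subspaces of codimension one. -/
structure CentralArrangement (V : Type*) [AddCommGroup V] [Module ℝ V] where
  /-- The hyperplanes of the arrangement. -/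
  hyperplanes : Finset (Submodule ℝ V)
  codim_one : ∀ H ∈ hyperplanes, Module.finrank ℝ (V ⧸ H) = 1

namespace CentralArrangement

section Algebra

variable {V : Type*} [AddCommGroup V] [Module ℝ V]

/-- The center of the arrangement: the intersection of all of its hyperplanes (all of `V` for the
empty arrangement). -/
def center (A : CentralArrangement V) : Submodule ℝ V :=
  A.hyperplanes.inf id

/-- The arrangement is essential if its center is the origin. -/
def IsEssential (A : CentralArrangement V) : Prop :=
  A.center = ⊥

/-- The rank: the dimension of the ambient space minus the dimension of the center. -/
noncomputable def rank (A : CentralArrangement V) : ℕ :=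
  Module.finrank ℝ V - Module.finrank ℝ A.center

open Classical in
/-- The flats: the intersections of arbitrary subfamilies of hyperplanes. The empty subfamily gives
the flat `V`. -/
noncomputable def flats (A : CentralArrangement V) : Finset (Submodule ℝ V) :=
  A.hyperplanes.powerset.image fun S => S.inf id

theorem top_mem_flats (A : CentralArrangement V) : (⊤ : Submodule ℝ V) ∈ A.flats := by
  classical
  exact Finset.mem_image.2 ⟨∅, by simp, by simp⟩

/-- The intersection lattice: the flats, ordered by inverse inclusion. -/
abbrev IntersectionLattice (A : CentralArrangement V) : Type _ :=
  {X : Submodule ℝ V // X ∈ A.flats}ᵒᵈ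

/-- The flat `V`, the least element of the intersection lattice. -/
def ambientFlat (A : CentralArrangement V) : A.IntersectionLattice :=
  OrderDual.toDual ⟨⊤, A.top_mem_flats⟩

/-- The linear subspace underlying an element of the intersection lattice. -/
def IntersectionLattice.toSubmodule {A : CentralArrangement V} (X : A.IntersectionLattice) :
    Submodule ℝ V :=
  (OrderDual.ofDual X).1

open Classical in
noncomputable instance (A : CentralArrangement V) : LocallyFiniteOrder A.IntersectionLattice :=
  Fintype.toLocallyFiniteOrder

open Classical in
/-- The characteristic polynomial `χ(A, t) = ∑_X μ(V, X) t ^ dim X`, where `X` runs over the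
intersection lattice and `μ` is its Möbius function. -/
noncomputable def charPoly (A : CentralArrangement V) : Polynomial ℤ :=
  ∑ X : A.IntersectionLattice,
    Polynomial.C (IncidenceAlgebra.mu ℤ A.ambientFlat X) *
      Polynomial.X ^ Module.finrank ℝ (IntersectionLattice.toSubmodule X)

/-- Crapo's beta invariant `β(A) = (-1) ^ (rank A - 1) * χ'(A, 1)`; the exponent is an integer. -/
noncomputable def beta (A : CentralArrangement V) : ℤ :=
  (((A.rank : ℤ) - 1).negOnePow : ℤ) * (Polynomial.derivative A.charPoly).eval 1

/-- The complement of the union of the hyperplanes. -/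
def complement (A : CentralArrangement V) : Set V :=
  {x | ∀ H ∈ A.hyperplanes, x ∉ H}

open Classical in
/-- The faraway planes of a closed chamber `C`: the hyperplanes of the arrangement that meet `C`
exactly in the origin. -/
noncomputable def farawayPlanes (A : CentralArrangement V) (C : Set V) :
    Finset (Submodule ℝ V) :=
  {H ∈ A.hyperplanes | (H : Set V) ∩ C = {0}}

open Classical in
/-- The faraway planes of `C` that belong to the set `P`. -/
noncomputable def farawayPlanesIn (A : CentralArrangement V) (P : Finset (Submodule ℝ V))
    (C : Set V) : Finset (Submodule ℝ V) :=
  {H ∈ P | H ∈ A.farawayPlanes C}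

end Algebra

section Chambers

variable {V : Type*} [NormedAddCommGroup V] [NormedSpace ℝ V]

/-- The (closed) chambers, as a set of subsets of `V`: the closures of the connected components of
the complement of the hyperplanes. -/
def chamberSet (A : CentralArrangement V) : Set (Set V) :=
  {C | ∃ x ∈ A.complement, C = closure (connectedComponentIn A.complement x)}

theorem chamberSet_finite (A : CentralArrangement V) : A.chamberSet.Finite := by
  classical
  have hf : ∀ H : A.hyperplanes, ∃ f : V →ₗ[ℝ] ℝ, ∀ x, f x = 0 ↔ x ∈ H.1 := by
    intro H
    have h1 := A.codim_one H.1 H.2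
    have : FiniteDimensional ℝ (V ⧸ H.1) := Module.finite_of_finrank_eq_succ h1
    obtain ⟨e⟩ := FiniteDimensional.nonempty_linearEquiv_of_finrank_eq
      (h1.trans (Module.finrank_self ℝ).symm)
    refine ⟨e.toLinearMap ∘ₗ H.1.mkQ, fun x => ?_⟩
    simp
  choose f hf using hf
  have key : ∀ x ∈ A.complement, ∀ y ∈ A.complement, (∀ H, 0 < f H x ↔ 0 < f H y) →
      connectedComponentIn A.complement x = connectedComponentIn A.complement y := by
    intro x hx y hy h
    have hsub : segment ℝ x y ⊆ A.complement := by
      rintro z ⟨a, b, ha, hb, hab, rfl⟩ H hH hz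
      have hx0 : f ⟨H, hH⟩ x ≠ 0 := fun h0 => hx H hH ((hf ⟨H, hH⟩ x).1 h0)
      have hy0 : f ⟨H, hH⟩ y ≠ 0 := fun h0 => hy H hH ((hf ⟨H, hH⟩ y).1 h0)
      have h0 := (hf ⟨H, hH⟩ _).2 hz
      have hs := h ⟨H, hH⟩
      simp only [map_add, map_smul, smul_eq_mul] at h0
      obtain rfl : b = 1 - a := by linarith
      rcases lt_or_gt_of_ne hx0 with hneg | hpos
      · have hy1 : f ⟨H, hH⟩ y < 0 :=
          lt_of_le_of_ne (not_lt.1 fun h2 => absurd (hs.2 h2) hneg.not_gt) hy0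
        rcases ha.eq_or_lt with rfl | ha'
        · simp at h0; exact hy0 h0
        · nlinarith [mul_neg_of_pos_of_neg ha' hneg, mul_nonpos_of_nonneg_of_nonpos hb hy1.le]
      · have hy1 : 0 < f ⟨H, hH⟩ y := hs.1 hpos
        rcases ha.eq_or_lt with rfl | ha'
        · simp at h0; exact hy0 h0
        · nlinarith [mul_pos ha' hpos, mul_nonneg hb hy1.le]
    exact connectedComponentIn_eq
      ((convex_segment x y).isPreconnected.subset_connectedComponentIn
        (left_mem_segment ℝ x y) hsub (right_mem_segment ℝ x y))
  choose p hp hpC using fun C : A.chamberSet => C.2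
  have hinj : Function.Injective fun (C : A.chamberSet) (H : A.hyperplanes) =>
      decide (0 < f H (p C)) := by
    intro C D hCD
    have h : ∀ H, 0 < f H (p C) ↔ 0 < f H (p D) := fun H =>
      decide_eq_decide.1 (congrFun hCD H)
    apply Subtype.ext
    rw [hpC C, hpC D, key _ (hp C) _ (hp D) h]
  exact Set.finite_coe_iff.1 (Finite.of_injective _ hinj)

/-- The finite set of chambers. -/
noncomputable def chambers (A : CentralArrangement V) : Finset (Set V) :=
  A.chamberSet_finite.toFinset

end Chambers

end CentralArrangement

/-!
Exchanging the sums over chambers and over `P` reduces the claim to a count for one hyperplane `H`: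
exactly `2 β(A)` chambers meet `H` only in the origin (`card_chambers_faraway`). Let `f H` be a
functional with kernel `H`. The chambers in question are the cones over the bounded cells of the
affine arrangements that `A \ {H}` induces on `{f H = 1}` and on `{f H = -1}`, so that it is enough
to count the bounded cells of an essential affine arrangement.

For the affine arrangement on `U ∩ {g = 1}` the number of bounded cells is
`(-1) ^ (dim U - 1)` times the alternating number of the subfamilies with nonempty intersection
(`neg_one_pow_mul_eulerSum`). Both sides satisfy a deletion-restriction recursion: a new hyperplane
adds as many bounded cells as there are bounded cells in its slice (`boundedCell_cut`), because a
pointed recession cone that meets the hyperplane only in the origin lies on one side of it. The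
recursion needs the deletion to be essential; otherwise the new hyperplane is an isthmus, and
both sides vanish. The statement is proved for all subspaces `U` at once, and functionals that
coincide, or vanish, on `U` are allowed, so that restrictions stay within the same family.

On the other side, Whitney's theorem `μ(V, X) = ∑_{⋂ S = X} (-1) ^ |S|` (`mu_eq_sum_powerset`) gives
`χ'(A, 1) = ∑_S (-1) ^ |S| dim ⋂ S`. Pairing `S` with `S ∪ {H}` leaves the sum of `(-1) ^ |S|` over
those `S ⊆ A \ {H}` whose intersection is not contained in `H`, that is, meets `{f H = 1}`.
-/


/-! ### Cells of a finite family of functionals -/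

section Cells

variable {V ι : Type*} [AddCommGroup V] [Module ℝ V]

open Classical in
/-- The sign vector of a set `T` of indices: `1` on `T` and `-1` off `T`. -/
noncomputable def signOf (T : Finset ι) (i : ι) : ℝ :=
  if i ∈ T then 1 else -1

/-- The open cell of sign vector `T` cut out by the functionals `f i`, `i ∈ s`. It may be empty. -/
def openCell (f : ι → Module.Dual ℝ V) (s T : Finset ι) : Set V :=
  {x | ∀ i ∈ s, 0 < signOf T i * f i x}

/-- The cone of the weak inequalities of `openCell`. -/
def closedCell (f : ι → Module.Dual ℝ V) (s T : Finset ι) : Set V :=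
  {x | ∀ i ∈ s, 0 ≤ signOf T i * f i x}

theorem signOf_ne_zero (T : Finset ι) (i : ι) : signOf T i ≠ 0 := by
  unfold signOf; split_ifs <;> norm_num

theorem signOf_insert_of_ne [DecidableEq ι] (T : Finset ι) {i j : ι} (h : i ≠ j) :
    signOf (insert j T) i = signOf T i := by
  simp [signOf, h]

theorem mem_openCell_insert [DecidableEq ι] (f : ι → Module.Dual ℝ V) {s T : Finset ι} {j : ι}
    (hT : j ∉ T) (x : V) :
    x ∈ openCell f (insert j s) T ↔ f j x < 0 ∧ x ∈ openCell f s T := by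
  simp [openCell, signOf, hT]

theorem mem_openCell_insert_insert [DecidableEq ι] (f : ι → Module.Dual ℝ V) {s T : Finset ι}
    {j : ι} (hs : j ∉ s) (x : V) :
    x ∈ openCell f (insert j s) (insert j T) ↔ 0 < f j x ∧ x ∈ openCell f s T := by
  have h : ∀ i ∈ s, signOf (insert j T) i = signOf T i := fun i hi =>
    signOf_insert_of_ne T (ne_of_mem_of_not_mem hi hs)
  have hj : signOf (insert j T) j = 1 := by simp [signOf]
  simp +contextual [openCell, hj, h]

theorem mem_closedCell_insert [DecidableEq ι] (f : ι → Module.Dual ℝ V) {s T : Finset ι} {j : ι}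
    (hT : j ∉ T) (x : V) :
    x ∈ closedCell f (insert j s) T ↔ f j x ≤ 0 ∧ x ∈ closedCell f s T := by
  simp [closedCell, signOf, hT]

theorem mem_closedCell_insert_insert [DecidableEq ι] (f : ι → Module.Dual ℝ V) {s T : Finset ι}
    {j : ι} (hs : j ∉ s) (x : V) :
    x ∈ closedCell f (insert j s) (insert j T) ↔ 0 ≤ f j x ∧ x ∈ closedCell f s T := by
  have h : ∀ i ∈ s, signOf (insert j T) i = signOf T i := fun i hi =>
    signOf_insert_of_ne T (ne_of_mem_of_not_mem hi hs)
  have hj : signOf (insert j T) j = 1 := by simp [signOf]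
  simp +contextual [closedCell, hj, h]

theorem smul_add_smul_mem_openCell {f : ι → Module.Dual ℝ V} {s T : Finset ι} {x y : V}
    {a b : ℝ} (hx : x ∈ openCell f s T) (hy : y ∈ closedCell f s T) (ha : 0 < a) (hb : 0 ≤ b) :
    a • x + b • y ∈ openCell f s T := fun i hi => by
  have h1 := mul_pos ha (hx i hi)
  have h2 := mul_nonneg hb (hy i hi)
  simp only [map_add, map_smul, smul_eq_mul]
  linarith

theorem smul_add_smul_mem_closedCell {f : ι → Module.Dual ℝ V} {s T : Finset ι} {x y : V}
    {a b : ℝ} (hx : x ∈ closedCell f s T) (hy : y ∈ closedCell f s T) (ha : 0 ≤ a) (hb : 0 ≤ b) :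
    a • x + b • y ∈ closedCell f s T := fun i hi => by
  have h1 := mul_nonneg ha (hx i hi)
  have h2 := mul_nonneg hb (hy i hi)
  simp only [map_add, map_smul, smul_eq_mul]
  linarith

theorem openCell_subset_closedCell (f : ι → Module.Dual ℝ V) (s T : Finset ι) :
    openCell f s T ⊆ closedCell f s T := fun _ hx i hi => (hx i hi).le

/-- Open cells are stable under small displacements along a line. -/
theorem eventually_add_smul_mem_openCell {f : ι → Module.Dual ℝ V} {s T : Finset ι} {x : V}
    (hx : x ∈ openCell f s T) (u : V) :
    ∀ᶠ t : ℝ in nhds 0, x + t • u ∈ openCell f s T := by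
  refine (Finset.eventually_all s).2 fun i hi => ?_
  have hc : Continuous fun t : ℝ => signOf T i * f i (x + t • u) := by
    simp only [map_add, map_smul, smul_eq_mul]; fun_prop
  have h0 : (0 : ℝ) < (fun t : ℝ => signOf T i * f i (x + t • u)) 0 := by simpa using hx i hi
  exact hc.continuousAt.eventually (lt_mem_nhds h0)

/-- The open cell, cut down to the affine space `U ∩ {g = 1}`, is nonempty and bounded.
Nonemptiness is stated on the cone `{0 < g}` over this affine space, and boundedness says that
the recession cone, which lies in `{g = 0}`, is trivial. -/
def IsBoundedCell (f : ι → Module.Dual ℝ V) (g : Module.Dual ℝ V) (U : Submodule ℝ V)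
    (s T : Finset ι) : Prop :=
  (∃ x ∈ U, 0 < g x ∧ x ∈ openCell f s T) ∧ ∀ x ∈ U, g x = 0 → x ∈ closedCell f s T → x = 0

open Classical in
/-- The number of bounded cells of the affine arrangement that the `f i`, `i ∈ s`, induce on
`U ∩ {g = 1}`. -/
noncomputable def boundedCount (f : ι → Module.Dual ℝ V) (g : Module.Dual ℝ V)
    (U : Submodule ℝ V) (s : Finset ι) : ℤ :=
  ∑ T ∈ s.powerset, if IsBoundedCell f g U s T then 1 else 0

open Classical in
/-- The alternating number of the subfamilies of `s` whose common zero set meets `U ∩ {g = 1}`: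
the value at `1` of the characteristic polynomial of the induced affine arrangement. The
condition `g x ≠ 0` is equivalent to `g x = 1` up to scaling `x`, and is symmetric in `g`. -/
noncomputable def eulerSum (f : ι → Module.Dual ℝ V) (g : Module.Dual ℝ V)
    (U : Submodule ℝ V) (s : Finset ι) : ℤ :=
  ∑ S ∈ s.powerset, (-1) ^ S.card * if ∃ x ∈ U, g x ≠ 0 ∧ ∀ i ∈ S, f i x = 0 then 1 else 0

/-- A pointed cone that meets the hyperplane `h = 0` only in the origin lies on one side of it. -/
theorem closedCell_one_side {f : ι → Module.Dual ℝ V} {g : Module.Dual ℝ V}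
    {U : Submodule ℝ V} {s : Finset ι}
    (hess : ∀ x ∈ U, g x = 0 → (∀ i ∈ s, f i x = 0) → x = 0) {T : Finset ι}
    {h : Module.Dual ℝ V}
    (h0 : ∀ x ∈ U, g x = 0 → h x = 0 ∧ x ∈ closedCell f s T → x = 0) :
    (∀ x ∈ U, g x = 0 → h x ≤ 0 ∧ x ∈ closedCell f s T → x = 0) ∨
      ∀ x ∈ U, g x = 0 → 0 ≤ h x ∧ x ∈ closedCell f s T → x = 0 := by
  by_contra! hcon
  obtain ⟨⟨x, hxU, hgx, ⟨hhx, hxK⟩, hx0⟩, y, hyU, hgy, ⟨hhy, hyK⟩, hy0⟩ := hcon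
  have hx' : h x < 0 := lt_of_le_of_ne hhx fun e => hx0 (h0 x hxU hgx ⟨e, hxK⟩)
  have hy' : 0 < h y := lt_of_le_of_ne hhy fun e => hy0 (h0 y hyU hgy ⟨e.symm, hyK⟩)
  have hz := h0 (h y • x + (-h x) • y) (U.add_mem (U.smul_mem _ hxU) (U.smul_mem _ hyU))
    (by simp [hgx, hgy])
    ⟨by simp; ring, smul_add_smul_mem_closedCell hxK hyK hy'.le (by linarith)⟩
  -- `x` and `y` are opposite up to scaling, so that the cone contains the line they span.
  refine hx0 (hess x hxU hgx fun i hi => ?_)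
  have e := congrArg (f i) hz
  simp only [map_add, map_smul, smul_eq_mul, map_zero] at e
  have h1 := hxK i hi
  have h2 := hyK i hi
  have e2 : h y * (signOf T i * f i x) = h x * (signOf T i * f i y) := by
    linear_combination signOf T i * e
  have h3 := mul_nonpos_of_nonpos_of_nonneg hx'.le h2
  have h4 : signOf T i * f i x = 0 := by nlinarith
  exact (mul_eq_zero.1 h4).resolve_left (signOf_ne_zero T i)

/-- If a nonempty cell has no point on the side `h < 0`, neither has its recession cone. -/
theorem nonneg_of_mem_closedCell {f : ι → Module.Dual ℝ V} {g : Module.Dual ℝ V}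
    {U : Submodule ℝ V} {s T : Finset ι} {h : Module.Dual ℝ V}
    (hne : ∃ x ∈ U, 0 < g x ∧ x ∈ openCell f s T)
    (hneg : ¬ ∃ x ∈ U, 0 < g x ∧ h x < 0 ∧ x ∈ openCell f s T) {y : V} (hyU : y ∈ U)
    (hgy : g y = 0) (hy : y ∈ closedCell f s T) : 0 ≤ h y := by
  by_contra! hlt
  obtain ⟨x, hxU, hgx, hx⟩ := hne
  refine hneg ⟨(-h y) • x + (|h x| + 1) • y, U.add_mem (U.smul_mem _ hxU) (U.smul_mem _ hyU),
    ?_, ?_, smul_add_smul_mem_openCell hx hy (by linarith) (by positivity)⟩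
  · simp [hgy]; nlinarith
  · simp; nlinarith [le_abs_self (h x)]

/-- A cell that meets the hyperplane `h = 0` meets the side `0 < h`. -/
theorem exists_pos_of_exists_zero {f : ι → Module.Dual ℝ V} {g : Module.Dual ℝ V}
    {U : Submodule ℝ V} {s T : Finset ι} {h : Module.Dual ℝ V} (hU : ∃ u ∈ U, h u ≠ 0)
    (hz : ∃ x ∈ U, 0 < g x ∧ h x = 0 ∧ x ∈ openCell f s T) :
    ∃ x ∈ U, 0 < g x ∧ 0 < h x ∧ x ∈ openCell f s T := by
  obtain ⟨x, hxU, hgx, hhx, hx⟩ := hz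
  obtain ⟨u, huU, hu⟩ := hU
  have hev := eventually_add_smul_mem_openCell hx (h u • u)
  have hc : Continuous fun t : ℝ => g (x + t • h u • u) := by
    simp only [map_add, map_smul, smul_eq_mul]; fun_prop
  have hev2 : ∀ᶠ t : ℝ in nhds 0, 0 < g (x + t • h u • u) :=
    hc.continuousAt.eventually (lt_mem_nhds (by simpa using hgx))
  obtain ⟨t, ⟨ht1, ht2⟩, ht⟩ := (((hev.and hev2).filter_mono nhdsWithin_le_nhds).and
    (self_mem_nhdsWithin : Set.Ioi (0 : ℝ) ∈ nhdsWithin 0 (Set.Ioi 0))).exists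
  refine ⟨_, U.add_mem hxU (U.smul_mem t (U.smul_mem (h u) huU)), ht2, ?_, ht1⟩
  have : 0 < t * (h u * h u) := mul_pos ht (mul_self_pos.2 hu)
  simpa [hhx] using this

theorem exists_zero_of_exists_neg_of_exists_pos {f : ι → Module.Dual ℝ V} {g : Module.Dual ℝ V}
    {U : Submodule ℝ V} {s T : Finset ι} {h : Module.Dual ℝ V}
    (hn : ∃ x ∈ U, 0 < g x ∧ h x < 0 ∧ x ∈ openCell f s T)
    (hp : ∃ x ∈ U, 0 < g x ∧ 0 < h x ∧ x ∈ openCell f s T) :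
    ∃ x ∈ U, 0 < g x ∧ h x = 0 ∧ x ∈ openCell f s T := by
  obtain ⟨x, hxU, hgx, hhx, hx⟩ := hn
  obtain ⟨y, hyU, hgy, hhy, hy⟩ := hp
  refine ⟨h y • x + (-h x) • y, U.add_mem (U.smul_mem _ hxU) (U.smul_mem _ hyU), ?_, ?_,
    smul_add_smul_mem_openCell hx (openCell_subset_closedCell f s T hy) hhy (by linarith)⟩
  · simp; nlinarith
  · simp; ring

open Classical in
/-- Cutting a cell by the hyperplane `h = 0`: the number of bounded pieces is the number of bounded
cells before the cut plus the number of bounded slices. -/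
theorem boundedCell_cut {f : ι → Module.Dual ℝ V} {g : Module.Dual ℝ V}
    {U : Submodule ℝ V} {s : Finset ι}
    (hess : ∀ x ∈ U, g x = 0 → (∀ i ∈ s, f i x = 0) → x = 0) (T : Finset ι)
    {h : Module.Dual ℝ V} (hU : ∃ u ∈ U, h u ≠ 0) :
    ((if (∃ x ∈ U, 0 < g x ∧ h x < 0 ∧ x ∈ openCell f s T) ∧
          ∀ x ∈ U, g x = 0 → h x ≤ 0 ∧ x ∈ closedCell f s T → x = 0 then 1 else 0) +
      if (∃ x ∈ U, 0 < g x ∧ 0 < h x ∧ x ∈ openCell f s T) ∧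
          ∀ x ∈ U, g x = 0 → 0 ≤ h x ∧ x ∈ closedCell f s T → x = 0 then 1 else 0 : ℤ) =
    (if IsBoundedCell f g U s T then 1 else 0) +
      if (∃ x ∈ U, 0 < g x ∧ h x = 0 ∧ x ∈ openCell f s T) ∧
          ∀ x ∈ U, g x = 0 → h x = 0 ∧ x ∈ closedCell f s T → x = 0 then 1 else 0 := by
  unfold IsBoundedCell
  set R := ∃ x ∈ U, 0 < g x ∧ x ∈ openCell f s T
  set K := ∀ x ∈ U, g x = 0 → x ∈ closedCell f s T → x = 0
  set Rn := ∃ x ∈ U, 0 < g x ∧ h x < 0 ∧ x ∈ openCell f s T with hRn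
  set Rp := ∃ x ∈ U, 0 < g x ∧ 0 < h x ∧ x ∈ openCell f s T with hRp
  set Rz := ∃ x ∈ U, 0 < g x ∧ h x = 0 ∧ x ∈ openCell f s T with hRz
  set Kn := ∀ x ∈ U, g x = 0 → h x ≤ 0 ∧ x ∈ closedCell f s T → x = 0
  set Kp := ∀ x ∈ U, g x = 0 → 0 ≤ h x ∧ x ∈ closedCell f s T → x = 0
  set Kz := ∀ x ∈ U, g x = 0 → h x = 0 ∧ x ∈ closedCell f s T → x = 0
  have a1 : Rz → Rp := exists_pos_of_exists_zero hU
  have a2 : Rz → Rn := fun hz => by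
    have := exists_pos_of_exists_zero (f := f) (g := g) (U := U) (s := s) (T := T) (h := -h)
      (by simpa using hU) (by simpa using hz)
    simpa [hRn] using this
  have a3 : Rn → Rp → Rz := exists_zero_of_exists_neg_of_exists_pos
  have a4 : R → Rn ∨ Rp := by
    rintro ⟨x, hxU, hgx, hx⟩
    rcases lt_trichotomy (h x) 0 with hlt | he | hgt
    · exact .inl ⟨x, hxU, hgx, hlt, hx⟩
    · exact .inr (a1 ⟨x, hxU, hgx, he, hx⟩)
    · exact .inr ⟨x, hxU, hgx, hgt, hx⟩
  have a5 : Rn → R := fun ⟨x, hxU, hgx, _, hx⟩ => ⟨x, hxU, hgx, hx⟩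
  have a6 : Rp → R := fun ⟨x, hxU, hgx, _, hx⟩ => ⟨x, hxU, hgx, hx⟩
  have b1 : R → ¬ Rn → Kp → K := fun hR hn hp x hxU hgx hx =>
    hp x hxU hgx ⟨nonneg_of_mem_closedCell hR hn hxU hgx hx, hx⟩
  have b2 : R → ¬ Rp → Kn → K := fun hR hn hp x hxU hgx hx => by
    refine hp x hxU hgx ⟨?_, hx⟩
    have := nonneg_of_mem_closedCell (h := -h) hR (by simpa [hRp] using hn) hxU hgx hx
    simpa using this
  have c1 : K → Kn := fun hK x hxU hgx hx => hK x hxU hgx hx.2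
  have c2 : K → Kp := fun hK x hxU hgx hx => hK x hxU hgx hx.2
  have c3 : Kn → Kz := fun hK x hxU hgx hx => hK x hxU hgx ⟨hx.1.le, hx.2⟩
  have c4 : Kp → Kz := fun hK x hxU hgx hx => hK x hxU hgx ⟨hx.1.ge, hx.2⟩
  have c5 : Kn → Kp → K := fun hn hp x hxU hgx hx =>
    (le_total (h x) 0).elim (fun l => hn x hxU hgx ⟨l, hx⟩) fun l => hp x hxU hgx ⟨l, hx⟩
  have c6 : Kz → Kn ∨ Kp := closedCell_one_side hess
  -- What remains is propositional: the cell lies on both sides of the cut, on one side, or is empty.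
  clear_value R K Rn Rp Rz Kn Kp Kz
  by_cases hn : Rn <;> by_cases hp : Rp
  · have hz := a3 hn hp
    have hR := a5 hn
    by_cases hK : K
    · simp [hn, hp, hz, hR, hK, c1 hK, c2 hK, c3 (c1 hK)]
    · by_cases hKn : Kn
      · have hKp : ¬ Kp := fun hKp => hK (c5 hKn hKp)
        simp [hn, hp, hz, hR, hK, hKn, hKp, c3 hKn]
      · by_cases hKp : Kp
        · simp [hn, hp, hz, hR, hK, hKn, hKp, c4 hKp]
        · have hKz : ¬ Kz := fun hKz => (c6 hKz).elim hKn hKp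
          simp [hK, hKn, hKp, hKz]
  · have hz : ¬ Rz := fun hz => hp (a1 hz)
    have hR := a5 hn
    have : Kn ↔ K := ⟨b2 hR hp, c1⟩
    simp [hn, hp, hz, hR, this]
  · have hz : ¬ Rz := fun hz => hn (a2 hz)
    have hR := a6 hp
    have : Kp ↔ K := ⟨b1 hR hn, c2⟩
    simp [hn, hp, hz, hR, this]
  · have hz : ¬ Rz := fun hz => hn (a2 hz)
    have hR : ¬ R := fun hR => (a4 hR).elim hn hp
    simp [hn, hp, hz, hR]

/-- Deletion and restriction for the number of bounded cells. -/
theorem boundedCount_insert [DecidableEq ι] {f : ι → Module.Dual ℝ V} {g : Module.Dual ℝ V}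
    {U : Submodule ℝ V} {s : Finset ι}
    (hess : ∀ x ∈ U, g x = 0 → (∀ i ∈ s, f i x = 0) → x = 0) {j : ι} (hj : j ∉ s)
    (hU : ∃ u ∈ U, f j u ≠ 0) :
    boundedCount f g U (insert j s) =
      boundedCount f g U s + boundedCount f g (U ⊓ LinearMap.ker (f j)) s := by
  classical
  unfold boundedCount
  rw [Finset.sum_powerset_insert hj, ← Finset.sum_add_distrib, ← Finset.sum_add_distrib]
  refine Finset.sum_congr rfl fun T hT => ?_
  have hjT : j ∉ T := fun h => hj (Finset.mem_powerset.1 hT h)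
  convert boundedCell_cut hess T hU using 3
  · simp only [IsBoundedCell, mem_openCell_insert f hjT, mem_closedCell_insert f hjT]
  · simp only [IsBoundedCell, mem_openCell_insert_insert f hj, mem_closedCell_insert_insert f hj]
  · simp only [IsBoundedCell, Submodule.mem_inf, LinearMap.mem_ker]
    refine and_congr (exists_congr fun x => by tauto) (forall_congr' fun x => by tauto)

/-- Deletion and restriction for the Euler sum. -/
theorem eulerSum_insert [DecidableEq ι] (f : ι → Module.Dual ℝ V) (g : Module.Dual ℝ V)
    (U : Submodule ℝ V) {s : Finset ι} {j : ι} (hj : j ∉ s) :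
    eulerSum f g U (insert j s) =
      eulerSum f g U s - eulerSum f g (U ⊓ LinearMap.ker (f j)) s := by
  classical
  unfold eulerSum
  rw [Finset.sum_powerset_insert hj, sub_eq_add_neg, ← Finset.sum_neg_distrib]
  congr 1
  refine Finset.sum_congr rfl fun T hT => ?_
  have hjT : j ∉ T := fun h => hj (Finset.mem_powerset.1 hT h)
  rw [Finset.card_insert_of_notMem hjT, pow_succ]
  have : (∃ x ∈ U, g x ≠ 0 ∧ ∀ i ∈ insert j T, f i x = 0) ↔
      ∃ x ∈ U ⊓ LinearMap.ker (f j), g x ≠ 0 ∧ ∀ i ∈ T, f i x = 0 := by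
    simp only [Finset.forall_mem_insert, Submodule.mem_inf, LinearMap.mem_ker]
    exact exists_congr fun x => by tauto
  simp only [this]
  ring

theorem boundedCount_insert_of_vanish [DecidableEq ι] {f : ι → Module.Dual ℝ V}
    {g : Module.Dual ℝ V} {U : Submodule ℝ V} {s : Finset ι} {j : ι}
    (hU : ∀ u ∈ U, f j u = 0) : boundedCount f g U (insert j s) = 0 := by
  refine Finset.sum_eq_zero fun T _ => if_neg ?_
  rintro ⟨⟨x, hxU, -, hx⟩, -⟩
  simpa [hU x hxU] using hx j (Finset.mem_insert_self j s)

theorem eulerSum_insert_of_vanish [DecidableEq ι] {f : ι → Module.Dual ℝ V}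
    {g : Module.Dual ℝ V} {U : Submodule ℝ V} {s : Finset ι} {j : ι} (hj : j ∉ s)
    (hU : ∀ u ∈ U, f j u = 0) : eulerSum f g U (insert j s) = 0 := by
  have : U ⊓ LinearMap.ker (f j) = U := inf_eq_left.2 fun u hu => hU u hu
  rw [eulerSum_insert f g U hj, this, sub_self]

/-- Every cell is unbounded in the direction `v` or `-v` if no functional other than possibly `f j`
is nonzero at `v`. -/
theorem boundedCount_insert_of_isthmus [DecidableEq ι] {f : ι → Module.Dual ℝ V}
    {g : Module.Dual ℝ V} {U : Submodule ℝ V} {s : Finset ι} {j : ι} {v : V}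
    (hvU : v ∈ U) (hgv : g v = 0) (hv : ∀ i ∈ s, f i v = 0) (hv0 : v ≠ 0) :
    boundedCount f g U (insert j s) = 0 := by
  refine Finset.sum_eq_zero fun T _ => if_neg ?_
  rintro ⟨-, hK⟩
  refine hv0 ((le_total 0 (signOf T j * f j v)).elim (fun h => hK v hvU hgv ?_) fun h =>
    neg_eq_zero.1 (hK (-v) (U.neg_mem hvU) (by simp [hgv]) ?_))
  · exact (Finset.forall_mem_insert _ _ _).2 ⟨h, fun i hi => by simp [hv i hi]⟩
  · exact (Finset.forall_mem_insert _ _ _).2 ⟨by simpa using h, fun i hi => by simp [hv i hi]⟩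

/-- Every flat can be moved along `v` into the zero set of `f j` if `f j` is the only functional
that does not vanish at `v`. -/
theorem eulerSum_insert_of_isthmus [DecidableEq ι] {f : ι → Module.Dual ℝ V}
    {g : Module.Dual ℝ V} {U : Submodule ℝ V} {s : Finset ι} {j : ι} (hj : j ∉ s) {v : V}
    (hvU : v ∈ U) (hgv : g v = 0) (hv : ∀ i ∈ s, f i v = 0) (hjv : f j v ≠ 0) :
    eulerSum f g U (insert j s) = 0 := by
  classical
  rw [eulerSum_insert f g U hj, sub_eq_zero]
  refine Finset.sum_congr rfl fun S hS => ?_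
  congr 2
  refine propext ⟨?_, fun ⟨x, hxU, hx⟩ => ⟨x, hxU.1, hx⟩⟩
  rintro ⟨x, hxU, hgx, hx⟩
  refine ⟨x - (f j x / f j v) • v, ⟨U.sub_mem hxU (U.smul_mem _ hvU), ?_⟩, by simpa [hgv], ?_⟩
  · simp [hjv]
  · intro i hi
    simp [hx i hi, hv i (Finset.mem_powerset.1 hS hi)]

theorem finrank_inf_ker_add_one [FiniteDimensional ℝ V] {U : Submodule ℝ V}
    {h : Module.Dual ℝ V} (hU : ∃ u ∈ U, h u ≠ 0) :
    Module.finrank ℝ ↥(U ⊓ LinearMap.ker h) + 1 = Module.finrank ℝ U := by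
  have hne : h.domRestrict U ≠ 0 := by
    obtain ⟨u, huU, hu⟩ := hU
    exact fun e => hu (by simpa using LinearMap.congr_fun e ⟨u, huU⟩)
  have h1 := Module.Dual.finrank_ker_add_one_of_ne_zero hne
  have h2 : (LinearMap.ker (h.domRestrict U)).map U.subtype = U ⊓ LinearMap.ker h := by
    ext x
    simp [and_comm]
  rw [← h1, ← h2, ← (Submodule.equivMapOfInjective U.subtype U.subtype_injective
    (LinearMap.ker (h.domRestrict U))).finrank_eq]

/-- The number of bounded cells of an essential affine arrangement is its Euler sum, up to the
sign of its dimension, which is `finrank U - 1`. -/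
theorem neg_one_pow_mul_eulerSum [FiniteDimensional ℝ V] (f : ι → Module.Dual ℝ V)
    (g : Module.Dual ℝ V) (s : Finset ι) (U : Submodule ℝ V)
    (hess : ∀ x ∈ U, g x = 0 → (∀ i ∈ s, f i x = 0) → x = 0) :
    (-1) ^ Module.finrank ℝ U * eulerSum f g U s = -boundedCount f g U s := by
  classical
  induction s using Finset.induction_on generalizing U with
  | empty =>
    by_cases hU : ∃ u ∈ U, g u ≠ 0
    · have hbot : U ⊓ LinearMap.ker g = ⊥ :=
        (Submodule.eq_bot_iff _).2 fun x hx => hess x hx.1 hx.2 (by simp)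
      have hr := finrank_inf_ker_add_one hU
      rw [hbot, finrank_bot, zero_add] at hr
      have hpos : ∃ x ∈ U, 0 < g x := by
        obtain ⟨u, huU, hu⟩ := hU
        exact ⟨g u • u, U.smul_mem _ huU, by simpa using mul_self_pos.2 hu⟩
      have hb : IsBoundedCell f g U ∅ ∅ :=
        ⟨by simpa [openCell] using hpos, fun x hx hgx _ => hess x hx hgx (by simp)⟩
      simp [eulerSum, boundedCount, ← hr, hU, Finset.filter_singleton, hb]
    · have hb : ¬ IsBoundedCell f g U ∅ ∅ := fun ⟨⟨x, hxU, hgx, _⟩, _⟩ => hU ⟨x, hxU, hgx.ne'⟩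
      have hU' : ∀ x ∈ U, g x = 0 := by simpa using hU
      simp +contextual [eulerSum, boundedCount, hU', Finset.filter_singleton, hb]
  | insert j s hj ih =>
    by_cases hU : ∃ u ∈ U, f j u ≠ 0
    · by_cases hs : ∀ x ∈ U, g x = 0 → (∀ i ∈ s, f i x = 0) → x = 0
      · have h1 := ih U hs
        have h2 := ih (U ⊓ LinearMap.ker (f j)) fun x hx => hs x hx.1
        rw [boundedCount_insert hs hj hU, eulerSum_insert f g U hj]
        rw [← finrank_inf_ker_add_one hU, pow_succ] at h1 ⊢
        linear_combination h1 + h2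
      · push Not at hs
        obtain ⟨v, hvU, hgv, hv, hv0⟩ := hs
        have hjv : f j v ≠ 0 := fun e =>
          hv0 (hess v hvU hgv ((Finset.forall_mem_insert _ _ _).2 ⟨e, hv⟩))
        rw [eulerSum_insert_of_isthmus hj hvU hgv hv hjv,
          boundedCount_insert_of_isthmus hvU hgv hv hv0]
        simp
    · push Not at hU
      rw [eulerSum_insert_of_vanish hj hU, boundedCount_insert_of_vanish hU]
      simp

end Cells

/-! ### Whitney's formula for the characteristic polynomial -/

namespace CentralArrangement

section Whitney

variable {V : Type*} [AddCommGroup V] [Module ℝ V]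

theorem inf_mem_flats (A : CentralArrangement V) {S : Finset (Submodule ℝ V)}
    (hS : S ⊆ A.hyperplanes) : S.inf id ∈ A.flats := by
  classical
  exact Finset.mem_image.2 ⟨S, Finset.mem_powerset.2 hS, rfl⟩

theorem toSubmodule_injective (A : CentralArrangement V) :
    Function.Injective (IntersectionLattice.toSubmodule (A := A)) :=
  fun _ _ h => OrderDual.ofDual.injective (Subtype.ext h)

theorem mem_Icc_ambientFlat (A : CentralArrangement V) (X Y : A.IntersectionLattice) :
    Y ∈ Finset.Icc A.ambientFlat X ↔ X.toSubmodule ≤ Y.toSubmodule := by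
  have : A.ambientFlat ≤ Y := show Y.toSubmodule ≤ ⊤ from le_top
  rw [Finset.mem_Icc]
  exact ⟨fun h => h.2, fun h => ⟨this, h⟩⟩

open Classical in
/-- Grouping the subfamilies of the arrangement by their intersection. -/
theorem sum_flats_sum_powerset (A : CentralArrangement V) (p : Submodule ℝ V → Prop)
    (F : Finset (Submodule ℝ V) → Submodule ℝ V → ℤ) :
    ∑ Y : A.IntersectionLattice with p Y.toSubmodule,
        ∑ S ∈ A.hyperplanes.powerset with S.inf id = Y.toSubmodule, F S Y.toSubmodule =
      ∑ S ∈ A.hyperplanes.powerset with p (S.inf id), F S (S.inf id) := by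
  simp_rw [Finset.sum_filter]
  rw [← Finset.sum_filter, Finset.sum_comm]
  refine Finset.sum_congr rfl fun S hS => ?_
  let Y₀ : A.IntersectionLattice :=
    OrderDual.toDual ⟨S.inf id, A.inf_mem_flats (Finset.mem_powerset.1 hS)⟩
  have h0 : Y₀.toSubmodule = S.inf id := rfl
  have h : ∀ Y : A.IntersectionLattice, S.inf id = Y.toSubmodule ↔ Y = Y₀ := fun Y => by
    rw [← h0, A.toSubmodule_injective.eq_iff, eq_comm]
  simp_rw [h]
  rw [Finset.sum_ite_eq']
  simp [h0]

open Classical in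
/-- Whitney's theorem: `μ(V, X)` is the alternating number of the subfamilies with
intersection `X`. -/
theorem mu_eq_sum_powerset (A : CentralArrangement V) (X : A.IntersectionLattice) :
    IncidenceAlgebra.mu ℤ A.ambientFlat X =
      ∑ S ∈ A.hyperplanes.powerset with S.inf id = X.toSubmodule, (-1) ^ S.card := by
  induction X using WellFoundedLT.induction with
  | ind X ih =>
  have hle : A.ambientFlat ≤ X := show X.toSubmodule ≤ ⊤ from le_top
  have h1 := IncidenceAlgebra.sum_Icc_mu_right (𝕜 := ℤ) A.ambientFlat X
  -- The alternating numbers satisfy the recursion that defines the Möbius function.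
  have h2 : ∑ Y ∈ Finset.Icc A.ambientFlat X,
      ∑ S ∈ A.hyperplanes.powerset with S.inf id = Y.toSubmodule, (-1 : ℤ) ^ S.card =
        if A.ambientFlat = X then 1 else 0 := by
    have hI : Finset.Icc A.ambientFlat X =
        ({Y | X.toSubmodule ≤ Y.toSubmodule} : Finset A.IntersectionLattice) := by
      ext Y; simp [mem_Icc_ambientFlat, -Finset.mem_Icc]
    have hP : ({S ∈ A.hyperplanes.powerset | X.toSubmodule ≤ S.inf id} :
        Finset (Finset (Submodule ℝ V))) =
          ({H ∈ A.hyperplanes | X.toSubmodule ≤ H} : Finset (Submodule ℝ V)).powerset := by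
      ext S
      simp only [Finset.mem_filter, Finset.mem_powerset, Finset.le_inf_iff, id,
        Finset.subset_iff]
      exact ⟨fun h H hH => ⟨h.1 hH, h.2 H hH⟩,
        fun h => ⟨fun H hH => (h hH).1, fun H hH => (h hH).2⟩⟩
    rw [hI, A.sum_flats_sum_powerset (fun Y => X.toSubmodule ≤ Y) (fun S _ => (-1) ^ S.card), hP,
      Finset.sum_powerset_neg_one_pow_card]
    refine if_congr ?_ rfl rfl
    rw [Finset.filter_eq_empty_iff]
    constructor
    · intro h
      refine A.toSubmodule_injective ?_
      obtain ⟨S, hS, hSX⟩ := Finset.mem_image.1 (OrderDual.ofDual X).2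
      have hSX' : S.inf id = X.toSubmodule := hSX
      have : S = ∅ := Finset.eq_empty_of_forall_notMem fun H hH =>
        h (Finset.mem_powerset.1 hS hH) (hSX' ▸ Finset.inf_le hH)
      rw [← hSX', this, Finset.inf_empty]
      rfl
    · rintro rfl H hH hle
      have hH' : H = ⊤ := top_le_iff.1 hle
      have := A.codim_one H hH
      rw [hH', Module.finrank_zero_of_subsingleton] at this
      exact zero_ne_one this
  have hIcc := Finset.Ico_insert_right hle
  rw [← hIcc, Finset.sum_insert Finset.right_notMem_Ico] at h1 h2
  rw [Finset.sum_congr rfl fun Y hY => ih Y (Finset.mem_Ico.1 hY).2] at h1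
  exact add_right_cancel (h1.trans h2.symm)

/-- The derivative at `1` of Whitney's formula. -/
theorem eval_derivative_charPoly (A : CentralArrangement V) :
    (Polynomial.derivative A.charPoly).eval 1 =
      ∑ S ∈ A.hyperplanes.powerset, (-1) ^ S.card * (Module.finrank ℝ ↥(S.inf id) : ℤ) := by
  classical
  have h := A.sum_flats_sum_powerset (fun _ => True)
    (fun S Y => (-1) ^ S.card * (Module.finrank ℝ Y : ℤ))
  simp only [Finset.filter_true] at h
  rw [← h, charPoly, Polynomial.derivative_sum, Polynomial.eval_finsetSum]
  refine Finset.sum_congr rfl fun Y _ => ?_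
  rw [← Finset.sum_mul]
  simp only [Polynomial.derivative_C_mul, Polynomial.derivative_X_pow, Polynomial.eval_mul,
    Polynomial.eval_C, Polynomial.eval_pow, Polynomial.eval_X, one_pow, mul_one]
  congr 1
  convert A.mu_eq_sum_powerset Y

/-- The derivative at `1` of the characteristic polynomial is the Euler sum of the affine
arrangement induced on `{f H = 1}`. -/
theorem eval_derivative_charPoly_eq_eulerSum [FiniteDimensional ℝ V] [DecidableEq (Submodule ℝ V)]
    (A : CentralArrangement V) {f : Submodule ℝ V → Module.Dual ℝ V}
    (hf : ∀ H ∈ A.hyperplanes, LinearMap.ker (f H) = H) {H : Submodule ℝ V}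
    (hH : H ∈ A.hyperplanes) :
    (Polynomial.derivative A.charPoly).eval 1 =
      eulerSum f (f H) ⊤ (A.hyperplanes.erase H) := by
  have hHs := Finset.notMem_erase H A.hyperplanes
  rw [eval_derivative_charPoly, ← Finset.insert_erase hH, Finset.sum_powerset_insert hHs,
    Finset.insert_erase hH, ← Finset.sum_add_distrib]
  unfold eulerSum
  refine Finset.sum_congr rfl fun S hS => ?_
  have hSs := Finset.mem_powerset.1 hS
  rw [Finset.card_insert_of_notMem fun h => hHs (hSs h), Finset.inf_insert, id, pow_succ]
  have hmem : ∀ x, (x ∈ (⊤ : Submodule ℝ V) ∧ f H x ≠ 0 ∧ ∀ i ∈ S, f i x = 0) ↔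
      x ∈ S.inf id ∧ f H x ≠ 0 := fun x => by
    have : (∀ i ∈ S, f i x = 0) ↔ x ∈ S.inf id := by
      rw [Submodule.mem_finsetInf]
      refine forall₂_congr fun i hi => ?_
      rw [← LinearMap.mem_ker, hf i (Finset.mem_of_mem_erase (hSs hi)), id]
    simp [this, and_comm]
  split_ifs with hx <;> rw [exists_congr hmem] at hx
  · have := finrank_inf_ker_add_one hx
    rw [hf H hH, inf_comm] at this
    rw [← this]
    push_cast
    ring
  · push Not at hx
    have : H ⊓ S.inf id = S.inf id := inf_eq_right.2 fun x h => by
      rw [← hf H hH]; exact hx x h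
    rw [this]
    ring

end Whitney

end CentralArrangement

/-! ### Chambers and sign vectors -/

namespace CentralArrangement

section Functionals

variable {V : Type*} [AddCommGroup V] [Module ℝ V]

/-- Every hyperplane of the arrangement is the kernel of a functional. -/
theorem exists_functionals (A : CentralArrangement V) :
    ∃ f : Submodule ℝ V → Module.Dual ℝ V, ∀ H ∈ A.hyperplanes, LinearMap.ker (f H) = H := by
  have h : ∀ H : Submodule ℝ V, ∃ φ : Module.Dual ℝ V, H ∈ A.hyperplanes → LinearMap.ker φ = H := by
    intro H
    by_cases hH : H ∈ A.hyperplanes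
    · have h1 := A.codim_one H hH
      have : FiniteDimensional ℝ (V ⧸ H) := Module.finite_of_finrank_eq_succ h1
      obtain ⟨e⟩ := FiniteDimensional.nonempty_linearEquiv_of_finrank_eq
        (h1.trans (Module.finrank_self ℝ).symm)
      refine ⟨e.toLinearMap ∘ₗ H.mkQ, fun _ => ?_⟩
      ext x
      simp
    · exact ⟨0, fun h => absurd h hH⟩
  choose f hf using h
  exact ⟨f, hf⟩

theorem mem_complement_iff {A : CentralArrangement V} {f : Submodule ℝ V → Module.Dual ℝ V}
    (hf : ∀ H ∈ A.hyperplanes, LinearMap.ker (f H) = H) {x : V} :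
    x ∈ A.complement ↔ ∀ H ∈ A.hyperplanes, f H x ≠ 0 :=
  forall₂_congr fun H hH => by rw [Ne, ← LinearMap.mem_ker, hf H hH]

theorem openCell_subset_complement {A : CentralArrangement V}
    {f : Submodule ℝ V → Module.Dual ℝ V}
    (hf : ∀ H ∈ A.hyperplanes, LinearMap.ker (f H) = H) (T : Finset (Submodule ℝ V)) :
    openCell f A.hyperplanes T ⊆ A.complement := fun x hx =>
  (mem_complement_iff hf).2 fun H hH h0 => by simpa [h0] using hx H hH

end Functionals

section Chambers

variable {V : Type*} [NormedAddCommGroup V] [NormedSpace ℝ V]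

theorem convex_openCell {ι : Type*} (f : ι → Module.Dual ℝ V) (s T : Finset ι) :
    Convex ℝ (openCell f s T) := fun x hx y hy a b ha hb hab i hi => by
  have h1 := hx i hi
  have h2 := hy i hi
  simp only [map_add, map_smul, smul_eq_mul]
  rcases ha.eq_or_lt with rfl | ha'
  · obtain rfl : b = 1 := by linarith
    linarith
  · nlinarith [mul_pos ha' h1, mul_nonneg hb h2.le]

theorem closure_openCell [FiniteDimensional ℝ V] {ι : Type*} {f : ι → Module.Dual ℝ V}
    {s T : Finset ι} (hne : (openCell f s T).Nonempty) :
    closure (openCell f s T) = closedCell f s T := by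
  refine subset_antisymm (closure_minimal (openCell_subset_closedCell f s T) ?_) fun y hy => ?_
  · simp only [closedCell, Set.ofPred_forall]
    refine isClosed_iInter fun i => isClosed_iInter fun _ => isClosed_le continuous_const ?_
    exact continuous_const.mul (f i).continuous_of_finiteDimensional
  · obtain ⟨x, hx⟩ := hne
    have hc : Filter.Tendsto (fun t : ℝ => t • x + (1 : ℝ) • y) (nhdsWithin 0 (Set.Ioi 0))
        (nhds y) := by
      have : Continuous fun t : ℝ => t • x + (1 : ℝ) • y := by fun_prop
      simpa using (this.tendsto 0).mono_left nhdsWithin_le_nhds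
    refine mem_closure_of_tendsto hc ?_
    filter_upwards [self_mem_nhdsWithin] with t ht
    exact smul_add_smul_mem_openCell hx hy ht zero_le_one

/-- The component of a point of an open cell in the complement is that open cell. -/
theorem connectedComponentIn_complement [FiniteDimensional ℝ V] {A : CentralArrangement V}
    {f : Submodule ℝ V → Module.Dual ℝ V}
    (hf : ∀ H ∈ A.hyperplanes, LinearMap.ker (f H) = H) {T : Finset (Submodule ℝ V)} {x : V}
    (hx : x ∈ openCell f A.hyperplanes T) :
    connectedComponentIn A.complement x = openCell f A.hyperplanes T := by
  refine subset_antisymm (fun y hy H hH => ?_)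
    ((convex_openCell f _ T).isPreconnected.subset_connectedComponentIn hx
      (openCell_subset_complement hf T))
  by_contra! hle
  -- A sign change along the component would give a zero of `f H` in the complement.
  have hc : Continuous fun z => signOf T H * f H z :=
    continuous_const.mul (f H).continuous_of_finiteDimensional
  have hxc := openCell_subset_complement hf T hx
  obtain ⟨z, hz, hz0⟩ := isPreconnected_connectedComponentIn.intermediate_value hy
    (mem_connectedComponentIn hxc) hc.continuousOn ⟨hle, (hx H hH).le⟩
  have hz1 := (mem_complement_iff hf).1 (connectedComponentIn_subset _ _ hz) H hH
  exact (mul_ne_zero (signOf_ne_zero T H) hz1) hz0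

open Classical in
/-- The chambers are the closed cells of the sign vectors with nonempty open cell. -/
theorem chambers_eq_image [FiniteDimensional ℝ V] {A : CentralArrangement V}
    {f : Submodule ℝ V → Module.Dual ℝ V}
    (hf : ∀ H ∈ A.hyperplanes, LinearMap.ker (f H) = H) :
    A.chambers = ({T ∈ A.hyperplanes.powerset | (openCell f A.hyperplanes T).Nonempty} :
      Finset _).image (closedCell f A.hyperplanes) := by
  ext C
  simp only [chambers, Set.Finite.mem_toFinset, chamberSet, Set.mem_ofPred_eq, Finset.mem_image,
    Finset.mem_filter, Finset.mem_powerset]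
  constructor
  · rintro ⟨x, hx, rfl⟩
    have hxT : x ∈ openCell f A.hyperplanes {H ∈ A.hyperplanes | 0 < f H x} := fun H hH => by
      have h0 := (mem_complement_iff hf).1 hx H hH
      rcases h0.lt_or_gt with h | h
      · simp [signOf, hH, h, h.not_gt]
      · simp [signOf, hH, h]
    exact ⟨_, ⟨Finset.filter_subset _ _, x, hxT⟩,
      by rw [connectedComponentIn_complement hf hxT, closure_openCell ⟨x, hxT⟩]⟩
  · rintro ⟨T, ⟨-, x, hx⟩, rfl⟩
    exact ⟨x, openCell_subset_complement hf T hx,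
      by rw [connectedComponentIn_complement hf hx, closure_openCell ⟨x, hx⟩]⟩

theorem closedCell_injOn {ι : Type*} (f : ι → Module.Dual ℝ V) (s : Finset ι) :
    Set.InjOn (closedCell f s) {T | T ⊆ s ∧ (openCell f s T).Nonempty} := by
  have key : ∀ T T' : Finset ι, T ⊆ s → (openCell f s T).Nonempty →
      closedCell f s T = closedCell f s T' → T ⊆ T' := by
    rintro T T' hT ⟨x, hx⟩ h i hi
    have h1 := hx i (hT hi)
    have h2 := (h ▸ openCell_subset_closedCell f s T hx : x ∈ closedCell f s T') i (hT hi)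
    by_contra hi'
    simp only [signOf, hi, hi', if_true, if_false] at h1 h2
    linarith
  exact fun T hT T' hT' h =>
    (key T T' hT.1 hT.2 h).antisymm (key T' T hT'.1 hT'.2 h.symm)

/-! ### Counting the chambers far away from a hyperplane -/

open Classical in
/-- The chambers that meet `H` only in the origin are the cones over the bounded cells of the two
affine arrangements induced on `{f H = 1}` and `{f H = -1}`. -/
theorem sum_chambers_inter_eq_boundedCount_add [FiniteDimensional ℝ V] {A : CentralArrangement V}
    {f : Submodule ℝ V → Module.Dual ℝ V}
    (hf : ∀ H ∈ A.hyperplanes, LinearMap.ker (f H) = H) {H : Submodule ℝ V}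
    (hH : H ∈ A.hyperplanes) :
    (∑ C ∈ A.chambers, if (H : Set V) ∩ C = {0} then 1 else 0 : ℤ) =
      boundedCount f (-f H) ⊤ (A.hyperplanes.erase H) +
        boundedCount f (f H) ⊤ (A.hyperplanes.erase H) := by
  have hHs := Finset.notMem_erase H A.hyperplanes
  have hzero : ∀ T, (H : Set V) ∩ closedCell f A.hyperplanes T = {0} ↔
      ∀ x, f H x = 0 → x ∈ closedCell f (A.hyperplanes.erase H) T → x = 0 := by
    intro T
    have hmem : ∀ x, x ∈ (H : Set V) ∩ closedCell f A.hyperplanes T ↔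
        f H x = 0 ∧ x ∈ closedCell f (A.hyperplanes.erase H) T := fun x => by
      have : x ∈ (H : Set V) ↔ f H x = 0 := by
        rw [SetLike.mem_coe, ← LinearMap.mem_ker, hf H hH]
      rw [Set.mem_inter_iff, this]
      refine and_congr_right fun h0 => ?_
      conv_lhs => rw [← Finset.insert_erase hH]
      simp only [closedCell, Set.mem_ofPred_eq]
      rw [Finset.forall_mem_insert]
      simp [h0]
    rw [Set.eq_singleton_iff_unique_mem]
    simp only [hmem, map_zero, true_and, and_imp]
    exact and_iff_right fun i _ => by simp
  rw [chambers_eq_image hf, Finset.sum_image fun T hT T' hT' h =>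
    closedCell_injOn f A.hyperplanes (by simpa using hT) (by simpa using hT') h,
    Finset.sum_filter]
  have hpow : A.hyperplanes.powerset = (insert H (A.hyperplanes.erase H)).powerset := by
    rw [Finset.insert_erase hH]
  rw [hpow, Finset.sum_powerset_insert hHs]
  unfold boundedCount
  congr 1 <;> refine Finset.sum_congr rfl fun T hT => ?_
  · have hHT : H ∉ T := fun h => hHs (Finset.mem_powerset.1 hT h)
    have h1 : (openCell f A.hyperplanes T).Nonempty ↔
        ∃ x ∈ (⊤ : Submodule ℝ V), 0 < (-f H) x ∧ x ∈ openCell f (A.hyperplanes.erase H) T := by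
      refine exists_congr fun x => ?_
      conv_lhs => rw [← Finset.insert_erase hH, mem_openCell_insert f hHT]
      simp
    rw [← ite_and]
    refine if_congr ?_ rfl rfl
    rw [IsBoundedCell, h1, hzero]
    simp
  · have h1 : (openCell f A.hyperplanes (insert H T)).Nonempty ↔
        ∃ x ∈ (⊤ : Submodule ℝ V), 0 < f H x ∧ x ∈ openCell f (A.hyperplanes.erase H) T := by
      refine exists_congr fun x => ?_
      conv_lhs => rw [← Finset.insert_erase hH, mem_openCell_insert_insert f hHs]
      simp
    have h2 : closedCell f (A.hyperplanes.erase H) (insert H T) =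
        closedCell f (A.hyperplanes.erase H) T := by
      ext x
      exact forall₂_congr fun i hi => by rw [signOf_insert_of_ne T (Finset.ne_of_mem_erase hi)]
    rw [← ite_and]
    refine if_congr ?_ rfl rfl
    rw [IsBoundedCell, h1, hzero, h2]
    simp

open Classical in
/-- Exactly `2 β(A)` chambers of an essential arrangement are far away from a given hyperplane. -/
theorem card_chambers_faraway [FiniteDimensional ℝ V] {A : CentralArrangement V}
    (hA : A.IsEssential) {H : Submodule ℝ V} (hH : H ∈ A.hyperplanes) :
    (∑ C ∈ A.chambers, if (H : Set V) ∩ C = {0} then 1 else 0 : ℤ) = 2 * A.beta := by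
  obtain ⟨f, hf⟩ := A.exists_functionals
  have hess : ∀ x, f H x = 0 → (∀ K ∈ A.hyperplanes.erase H, f K x = 0) → x = 0 := by
    intro x h0 hx
    have hc : x ∈ A.center := by
      rw [center, Submodule.mem_finsetInf]
      intro K hK
      rw [id, ← hf K hK, LinearMap.mem_ker]
      by_cases e : K = H
      · rw [e, h0]
      · exact hx K (Finset.mem_erase.2 ⟨e, hK⟩)
    rw [hA] at hc
    simpa using hc
  have hneg : eulerSum f (-f H) ⊤ (A.hyperplanes.erase H) =
      eulerSum f (f H) ⊤ (A.hyperplanes.erase H) := by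
    simp [eulerSum]
  have h1 := neg_one_pow_mul_eulerSum f (f H) (A.hyperplanes.erase H) ⊤ fun x _ => hess x
  have h2 := neg_one_pow_mul_eulerSum f (-f H) (A.hyperplanes.erase H) ⊤
    fun x _ h => hess x (by simpa using h)
  have hrank : A.rank = Module.finrank ℝ V := by
    rw [rank, show A.center = ⊥ from hA, finrank_bot, Nat.sub_zero]
  rw [sum_chambers_inter_eq_boundedCount_add hf hH, beta, eval_derivative_charPoly_eq_eulerSum A hf hH,
    hrank, Int.negOnePow_sub, Int.negOnePow_one]
  rw [hneg] at h2
  rw [finrank_top] at h1 h2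
  push_cast [Int.negOnePow_def, zpow_natCast]
  linear_combination h1 + h2

end Chambers

end CentralArrangement

theorem lemma2p9 {V : Type*} [NormedAddCommGroup V] [NormedSpace ℝ V] [FiniteDimensional ℝ V]
    (A : CentralArrangement V) (hA : A.IsEssential)
    (P : Finset (Submodule ℝ V)) (hP : P ⊆ A.hyperplanes) :
    ∑ C ∈ A.chambers, ((A.farawayPlanesIn P C).card : ℤ) = 2 * (P.card : ℤ) * A.beta := by
  classical
  have h : ∀ C, ((A.farawayPlanesIn P C).card : ℤ) =
      ∑ H ∈ P, if (H : Set V) ∩ C = {0} then 1 else 0 := fun C => by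
    have : A.farawayPlanesIn P C =
        ({H ∈ P | (H : Set V) ∩ C = {0}} : Finset (Submodule ℝ V)) := by
      ext H
      simp only [CentralArrangement.farawayPlanesIn, CentralArrangement.farawayPlanes,
        Finset.mem_filter]
      exact and_congr_right fun hH => and_iff_right (hP hH)
    rw [this, Finset.card_filter]
    push_cast
    rfl
  simp_rw [h]
  rw [Finset.sum_comm, Finset.sum_congr rfl fun H hH =>
    CentralArrangement.card_chambers_faraway hA (hP hH), Finset.sum_const, nsmul_eq_mul]
  ring
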